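/- Let $s\ge 1$ be an integer and let $A^{(s)}(n)=\sum_{k=0}^n\binom nk^s$ for $n\ge 0$. Let $$A^{(s)}(n,t)=\sum_{k=0}^n\binom nk^s\Bigl[\prod_{j=1}^k\Bigl(1-\frac tj\Bigr)\prod_{j=1}^{n-k}\Bigl(1+\frac tj\Bigr)\Bigr]^{-s}$$ (expanded as a power series at $t=0$ with rational coefficients). This is an even series, $A^{(s)}(n,t)=\sum_{j\ge 0}A^{(s)}_j(n)\,t^{2j}$, with $A_j^{(s)}(n)\in\mathbb Q$. A recurrence operator $P(n,N)=\sum_{i=0}^r p_i(n)N^i$ with polynomial coefficients $p_i\in\mathbb C[n]$, where $N$ is the shift $n\mapsto n+1$, is called a telescoping recurrence operator for $A^{(s)}(n)$ (based on the representation $A^{(s)}(n)=\sum_k\binom nk^s$) if there is a rational function $R(n,k)\in\mathbb C(n,k)$ such that $b(n,k)=R(n,k)\binom nk^s$ satisfies $$P(n,N)\binom nk^s=b(n,k+1)-b(n,k)$$ (for all integers $n,k\ge 0$ for which neither $(n,k)$ nor $(n,k+1)$ is a zero of the denominator of $R$; equivalently, as an identity of rational functions in $n,k$ after division by $\binom nk^s$).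 Then: 1. For every telescoping recurrence operator $P(n,N)$ for $A^{(s)}(n)$ there is an $n_0$ such that for all $n\ge n_0$ and all $j\in\{0,1,\ldots,\lfloor (s-1)/2\rfloor\}$ one has $P(n,N)A^{(s)}_j(n)=\sum_{i=0}^r p_i(n)A_j^{(s)}(n+i)=0$. 2. For every integer $j\ge 0$ (in particular for $0\le j\le\lfloor (s-1)/2\rfloor$), $$\lim_{n\to\infty}\frac{A^{(s)}_j(n)}{A^{(s)}(n)}=\varphi^{(s)}_j\,\pi^{2j},$$ where $\varphi^{(s)}_j\in\mathbb Q_{>0}$ is the coefficient of $t^{2j}$ in the power series of $(t/\sin t)^s$; in particular this coefficient is a positive rational number. -/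

import Mathlib

open Polynomial

/-- The generalized Franel numbers: the sum of the `s`-th powers of the binomial coefficients
`n.choose k`, `0 ≤ k ≤ n`. -/
def franel (s n : ℕ) : ℕ := ∑ k ∈ Finset.range (n + 1), n.choose k ^ s

/-- The product of `1 - t/j` for `1 ≤ j ≤ k` times the product of `1 + t/j` for `1 ≤ j ≤ n - k`,
as a power series in `t` with rational coefficients. It is only used for `k ≤ n`. -/
noncomputable def franelWeight (n k : ℕ) : PowerSeries ℚ :=
  (∏ j ∈ Finset.Icc 1 k, (1 - PowerSeries.C (1 / (j : ℚ)) * PowerSeries.X)) *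
    ∏ j ∈ Finset.Icc 1 (n - k), (1 + PowerSeries.C (1 / (j : ℚ)) * PowerSeries.X)

/-- The weight has constant term `1`, so the inverses taken below are genuine inverses. -/
theorem constantCoeff_franelWeight (n k : ℕ) :
    PowerSeries.constantCoeff (franelWeight n k) = 1 := by
  simp [franelWeight, map_prod]

/-- The expansion at `t = 0` of the weighted sum of the `s`-th powers of the binomial
coefficients, the weight of the `k`-th term being the `-s`-th power of `franelWeight n k`. -/
noncomputable def franelSeries (s n : ℕ) : PowerSeries ℚ :=
  ∑ k ∈ Finset.range (n + 1),
    PowerSeries.C ((n.choose k : ℚ) ^ s) * ((franelWeight n k)⁻¹) ^ s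

/-- The coefficient of `t ^ (2 * j)` in `franelSeries s n`. -/
noncomputable def franelCoeff (s j n : ℕ) : ℚ :=
  PowerSeries.coeff (2 * j) (franelSeries s n)

/-- The power series `sin t / t`. -/
noncomputable def sinDivX : PowerSeries ℚ :=
  PowerSeries.mk fun i => PowerSeries.coeff (i + 1) (PowerSeries.sin ℚ)

theorem X_mul_sinDivX : PowerSeries.X * sinDivX = PowerSeries.sin ℚ := by
  ext i
  cases i with
  | zero => simp [PowerSeries.sin]
  | succ i => simp [sinDivX, PowerSeries.coeff_succ_X_mul]

theorem constantCoeff_sinDivX : PowerSeries.constantCoeff sinDivX = 1 := by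
  simp [sinDivX, PowerSeries.sin, ← PowerSeries.coeff_zero_eq_constantCoeff_apply]

/-- The coefficient of `t ^ (2 * j)` in the power series `(t / sin t) ^ s`. -/
noncomputable def sinCoeff (s j : ℕ) : ℚ :=
  PowerSeries.coeff (2 * j) ((sinDivX⁻¹) ^ s)

/-- The action on sequences of the recurrence operator `P(n, N) = ∑ i, p i (n) * N ^ i`, where
`N` is the shift `n ↦ n + 1`. The operator is given by its coefficients: `P.coeff i` is the
polynomial `p i` in `n`. -/
noncomputable def recurrenceApply (P : ℂ[X][X]) (u : ℕ → ℂ) (n : ℕ) : ℂ :=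
  P.sum fun i p => p.eval (n : ℂ) * u (n + i)

/-- The value at the integer point `(n, k)` of `b(n, k) = R(n, k) * (n.choose k) ^ s`, where
`R = U / V` is a quotient of two polynomials in `n` (inner variable) and `k` (outer variable). -/
noncomputable def certificateTerm (s : ℕ) (U V : ℂ[X][X]) (n k : ℕ) : ℂ :=
  U.evalEval (n : ℂ) (k : ℂ) / V.evalEval (n : ℂ) (k : ℂ) * (n.choose k : ℂ) ^ s

/-- `P` is a telescoping recurrence operator for the generalized Franel numbers, based on their
representation as the sum of `(n.choose k) ^ s`: there is a rational function `R = U / V` in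
`n, k` such that `b(n, k) = R(n, k) * (n.choose k) ^ s` satisfies
`P(n, N) (n.choose k) ^ s = b(n, k + 1) - b(n, k)`, wherever the right-hand side is defined.
As `V` is not the zero polynomial, this is an identity on a Zariski-dense set of points, that is,
an identity of rational functions once it is divided by `(n.choose k) ^ s`. -/
def IsTelescopingOperator (s : ℕ) (P : ℂ[X][X]) : Prop :=
  ∃ U V : ℂ[X][X], V ≠ 0 ∧ ∀ n k : ℕ,
    V.evalEval (n : ℂ) (k : ℂ) ≠ 0 → V.evalEval (n : ℂ) ((k + 1 : ℕ) : ℂ) ≠ 0 →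
      recurrenceApply P (fun m => (m.choose k : ℂ) ^ s) n =
        certificateTerm s U V n (k + 1) - certificateTerm s U V n k

/-!
The weights come from a shift of the summation index. Put
`F(n, k) = binomial (n, k - t) / binomial (0, -t)`, a power series in `t` for every integer `k`
(`shiftedChoose`). For `0 ≤ k ≤ n` it is `n.choose k` divided by the weight
(`shiftedChoose_natCast`), and for all other `k` it is divisible by `t` (`X_dvd_shiftedChoose`), so
`franelSeries s n` is the sum of `F(n, k) ^ s` over any long enough range of integers `k`, modulo
`t ^ s`.

*Recurrences.* A telescoping equation for `(n.choose k) ^ s` is a polynomial identity in `n` and `k`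
(`telescopingNumerator_eq_zero`), because the points `0 ≤ k ≤ n` are Zariski dense. So it may be
evaluated at `k - t`, where it is a telescoping equation for `F(n, k) ^ s`, as `F` satisfies the
recurrences of the binomial coefficients. For large `n` the denominator of the certificate, as a
polynomial in `k`, is not zero. It then has no zero at `k - t`, and no zero at `k` once `|k|` is
large. Summation over a long range of `k` leaves two boundary terms with unit denominators, hence
divisible by `t ^ s`: the operator annihilates `franelSeries s n` modulo `t ^ s`
(`X_pow_dvd_sum_of_isTelescopingOperator`).

*Limits.* With `m = min k (n - k)`, the weight is the product of `1 - t ^ 2 / j ^ 2` for `1 ≤ j ≤ m`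
times further factors `1 ± t / j` with `m < j ≤ n - m`. If `n → ∞` and `k / n → 1 / 2`, the sum of
`1 / j` over these `j` tends to `0`, and the weight tends coefficientwise to `sin (π t) / (π t)` by
Euler's product (`tendsto_coeff_invWeight_pow`). The coefficients of the reciprocal weights grow at
most polynomially in `n` (`geometricBound_invWeight`), whereas the terms with `k / n` away from
`1 / 2` are exponentially small compared with the sum (`choose_le_exp_of_offCenter`), so the quotient
`franelCoeff s j n / franel s n` has the limit of its central terms (`tendsto_weighted_average`).
The limit is positive, since the reciprocals of the factors `1 - t ^ 2 / j ^ 2` have nonnegative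
coefficients.
-/

/-! ### Telescoping equations as polynomial identities -/

theorem recurrenceApply_eq_sum (P : ℂ[X][X]) (u : ℕ → ℂ) (n : ℕ) :
    recurrenceApply P u n =
      ∑ i ∈ Finset.range (P.natDegree + 1), (P.coeff i).eval (n : ℂ) * u (n + i) := by
  unfold recurrenceApply
  exact Polynomial.sum_over_range P (by simp)

/-- The numerator of `P(n, N) h / h - (b(n, k + 1) - b(n, k)) / h` for `h = (n.choose k) ^ s` and
`b = (U / V) h`, where the quotients of binomial coefficients have been written as rational
functions of `n` (inner variable) and `k` (outer variable). -/
noncomputable def telescopingNumerator (s : ℕ) (P U V : ℂ[X][X]) : ℂ[X][X] :=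
  (X + 1) ^ s * V * V.comp (X + 1) *
      (∑ i ∈ Finset.range (P.natDegree + 1), C (P.coeff i) *
        ((∏ l ∈ Finset.range i, (C X + (l : ℂ[X][X]) + 1)) *
          ∏ l ∈ Finset.Ico i P.natDegree, (C X + (l : ℂ[X][X]) + 1 - X)) ^ s) -
    (∏ l ∈ Finset.range P.natDegree, (C X + (l : ℂ[X][X]) + 1 - X)) ^ s *
      (U.comp (X + 1) * V * (C X - X) ^ s - U * V.comp (X + 1) * (X + 1) ^ s)

/-- Any `f i`, `g` which satisfy the recurrences of `(n + i).choose k` and `n.choose (k + 1)` turn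
a value of `telescopingNumerator` into the telescoping equation with denominators cleared. Both
the binomial coefficients and their deformations by `t` are such solutions. -/
theorem eval₂_telescopingNumerator {S : Type*} [CommRing S] (s : ℕ) (P U V : ℂ[X][X])
    (φ : ℂ[X] →+* S) (y : S) (f : ℕ → S) (g : S)
    (hf : ∀ i : ℕ, (φ X + i + 1 - y) * f (i + 1) = (φ X + i + 1) * f i)
    (hg : (y + 1) * g = (φ X - y) * f 0) :
    (telescopingNumerator s P U V).eval₂ φ y * f 0 ^ s =
      (y + 1) ^ s * (∏ l ∈ Finset.range P.natDegree, (φ X + l + 1 - y)) ^ s *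
        (V.eval₂ φ y * V.eval₂ φ (y + 1) *
            (∑ i ∈ Finset.range (P.natDegree + 1), φ (P.coeff i) * f i ^ s) -
          (U.eval₂ φ (y + 1) * V.eval₂ φ y * g ^ s -
            U.eval₂ φ y * V.eval₂ φ (y + 1) * f 0 ^ s)) := by
  -- `f i` is `f 0` times a product of quotients, here with the denominators cleared.
  have key : ∀ i, (∏ l ∈ Finset.range i, (φ X + l + 1 - y)) * f i =
      (∏ l ∈ Finset.range i, (φ X + l + 1)) * f 0 := by
    intro i
    induction i with
    | zero => simp
    | succ i ih =>
      rw [Finset.prod_range_succ, Finset.prod_range_succ, mul_assoc, hf]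
      linear_combination (φ X + i + 1) * ih
  have hsum : (∑ i ∈ Finset.range (P.natDegree + 1), φ (P.coeff i) *
        ((∏ l ∈ Finset.range i, (φ X + l + 1)) *
          ∏ l ∈ Finset.Ico i P.natDegree, (φ X + l + 1 - y)) ^ s) * f 0 ^ s =
      (∏ l ∈ Finset.range P.natDegree, (φ X + l + 1 - y)) ^ s *
        ∑ i ∈ Finset.range (P.natDegree + 1), φ (P.coeff i) * f i ^ s := by
    rw [Finset.sum_mul, Finset.mul_sum]
    refine Finset.sum_congr rfl fun i hi => ?_
    rw [← Finset.prod_range_mul_prod_Ico _ (Nat.lt_succ_iff.1 (Finset.mem_range.1 hi)),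
      mul_assoc, ← mul_pow, mul_right_comm, ← key]
    ring
  have hev : (telescopingNumerator s P U V).eval₂ φ y =
      (y + 1) ^ s * V.eval₂ φ y * V.eval₂ φ (y + 1) *
      (∑ i ∈ Finset.range (P.natDegree + 1), φ (P.coeff i) *
        ((∏ l ∈ Finset.range i, (φ X + l + 1)) *
          ∏ l ∈ Finset.Ico i P.natDegree, (φ X + l + 1 - y)) ^ s) -
    (∏ l ∈ Finset.range P.natDegree, (φ X + l + 1 - y)) ^ s *
      (U.eval₂ φ (y + 1) * V.eval₂ φ y * (φ X - y) ^ s -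
        U.eval₂ φ y * V.eval₂ φ (y + 1) * (y + 1) ^ s) := by
    rw [← Polynomial.coe_eval₂RingHom]
    simp only [telescopingNumerator, map_sub, map_mul, map_pow, map_sum, map_prod, map_add,
      map_natCast, map_one]
    simp only [Polynomial.coe_eval₂RingHom, eval₂_comp, eval₂_add, eval₂_X, eval₂_one, eval₂_C]
  rw [hev, sub_mul, mul_assoc _ _ (f 0 ^ s), hsum]
  have hgs : (y + 1) ^ s * g ^ s = (φ X - y) ^ s * f 0 ^ s := by
    rw [← mul_pow, hg, mul_pow]
  linear_combination (∏ l ∈ Finset.range P.natDegree, (φ X + l + 1 - y)) ^ s *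
    U.eval₂ φ (y + 1) * V.eval₂ φ y * hgs

/-- A polynomial which vanishes at all integer points `0 ≤ k ≤ n` is zero. -/
theorem eq_zero_of_evalEval_natCast {Q : ℂ[X][X]}
    (h : ∀ n k : ℕ, k ≤ n → Q.evalEval (n : ℂ) (k : ℂ) = 0) : Q = 0 := by
  have h1 : ∀ k : ℕ, Q.eval (C (k : ℂ)) = 0 := fun k =>
    Polynomial.eq_zero_of_infinite_isRoot _ <|
      ((Set.Ici_infinite k).image Nat.cast_injective.injOn).mono (by
        rintro _ ⟨n, hn, rfl⟩
        exact h n k hn)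
  refine Polynomial.eq_zero_of_infinite_isRoot _ <|
    (Set.infinite_range_of_injective
      (f := fun k : ℕ => (C (k : ℂ) : ℂ[X])) ?_).mono ?_
  · exact fun a b hab => Nat.cast_injective (C_injective hab)
  · rintro _ ⟨k, rfl⟩
    exact h1 k

theorem comp_X_add_one_ne_zero {V : ℂ[X][X]} (hV : V ≠ 0) : V.comp (X + 1) ≠ 0 := by
  intro h
  apply hV
  have := congrArg (fun p : ℂ[X][X] => p.comp (X - 1)) h
  simpa [Polynomial.comp_assoc] using this

/-- The telescoping equation is known only at the integer points where the denominators of the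
certificate do not vanish and, below the diagonal `k = n`, where it can be divided by
`n.choose k`; these points are Zariski dense. -/
theorem telescopingNumerator_eq_zero {s : ℕ} {P U V : ℂ[X][X]} (hV : V ≠ 0)
    (h : ∀ n k : ℕ, V.evalEval (n : ℂ) (k : ℂ) ≠ 0 →
      V.evalEval (n : ℂ) ((k + 1 : ℕ) : ℂ) ≠ 0 →
      recurrenceApply P (fun m => (m.choose k : ℂ) ^ s) n =
        certificateTerm s U V n (k + 1) - certificateTerm s U V n k) :
    telescopingNumerator s P U V = 0 := by
  -- The factor `V * V.comp (X + 1)` takes care of the excluded points.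
  have hQ : telescopingNumerator s P U V * (V * V.comp (X + 1)) = 0 := by
    refine eq_zero_of_evalEval_natCast fun n k hkn => ?_
    rw [← eval₂_evalRingHom, eval₂_mul, eval₂_mul, eval₂_comp, eval₂_add, eval₂_X, eval₂_one]
    by_cases hv : V.evalEval (n : ℂ) (k : ℂ) = 0
    · simp only [eval₂_evalRingHom, hv, zero_mul, mul_zero]
    by_cases hv' : V.evalEval (n : ℂ) ((k + 1 : ℕ) : ℂ) = 0
    · push_cast at hv'
      simp [eval₂_evalRingHom, hv']
    have ht := eval₂_telescopingNumerator s P U V (evalRingHom (n : ℂ)) (k : ℂ)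
      (fun i => ((n + i).choose k : ℂ)) (n.choose (k + 1) : ℂ) (fun i => by
        have := Nat.choose_mul_succ_eq (n + i) k
        have hc : ((n + i + 1 - k : ℕ) : ℂ) = (n : ℂ) + i + 1 - k := by
          rw [Nat.cast_sub (by omega)]; push_cast; ring
        have h3 := congrArg (Nat.cast : ℕ → ℂ) this
        push_cast [hc] at h3
        simp only [coe_evalRingHom, eval_X, ← add_assoc]
        linear_combination -h3) (by
        have := congrArg (Nat.cast : ℕ → ℂ) (Nat.choose_succ_right_eq n k)
        push_cast [Nat.cast_sub hkn] at this
        simp only [coe_evalRingHom, eval_X, add_zero]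
        linear_combination this)
    have h0 := h n k hv hv'
    rw [recurrenceApply_eq_sum] at h0
    simp only [coe_evalRingHom, eval_X] at ht
    rw [h0] at ht
    push_cast at hv'
    have hz : V.evalEval (n : ℂ) k * V.evalEval (n : ℂ) (k + 1) *
          (certificateTerm s U V n (k + 1) - certificateTerm s U V n k) -
        (U.evalEval (n : ℂ) (k + 1) * V.evalEval (n : ℂ) k * (n.choose (k + 1) : ℂ) ^ s -
          U.evalEval (n : ℂ) k * V.evalEval (n : ℂ) (k + 1) * (n.choose k : ℂ) ^ s) = 0 := by
      simp only [certificateTerm]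
      push_cast
      field_simp
      ring
    simp only [eval₂_evalRingHom] at ht ⊢
    simp only [add_zero] at ht
    rw [hz, mul_zero] at ht
    have hc : ((n.choose k : ℂ)) ^ s ≠ 0 :=
      pow_ne_zero _ (by exact_mod_cast (Nat.choose_pos hkn).ne')
    rw [(mul_eq_zero.1 ht).resolve_right hc, zero_mul]
  exact (mul_eq_zero.1 hQ).resolve_right (mul_ne_zero hV (comp_X_add_one_ne_zero hV))

/-! ### Shifted binomial coefficients -/

/-- The power series of `Γ(1 + c t) / Γ(m + 1 + c t)` for an integer `m`: the reciprocal of the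
factorial of `m`, shifted by `c t`. It is divisible by `t` when `m` is negative. -/
noncomputable def recipFactorial (c : ℂ) : ℤ → PowerSeries ℂ
  | Int.ofNat m => (∏ j ∈ Finset.range m, ((j : PowerSeries ℂ) + 1 + PowerSeries.C c * .X))⁻¹
  | Int.negSucc m => ∏ i ∈ Finset.range (m + 1), (PowerSeries.C c * .X - (i : PowerSeries ℂ))

theorem constantCoeff_natCast_add (c : ℂ) (j : ℕ) :
    PowerSeries.constantCoeff ((j : PowerSeries ℂ) + 1 + PowerSeries.C c * .X) = (j : ℂ) + 1 := by
  simp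

theorem constantCoeff_prod_natCast_add_ne_zero (c : ℂ) (m : ℕ) :
    PowerSeries.constantCoeff
      (∏ j ∈ Finset.range m, ((j : PowerSeries ℂ) + 1 + PowerSeries.C c * .X)) ≠ 0 := by
  rw [map_prod]
  refine Finset.prod_ne_zero_iff.2 fun j _ => ?_
  rw [constantCoeff_natCast_add]
  exact Nat.cast_add_one_ne_zero j

theorem prod_mul_recipFactorial (c : ℂ) (m : ℕ) :
    (∏ j ∈ Finset.range m, ((j : PowerSeries ℂ) + 1 + PowerSeries.C c * .X)) *
      recipFactorial c m = 1 :=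
  PowerSeries.mul_inv_cancel _ (constantCoeff_prod_natCast_add_ne_zero c m)

/-- The functional equation of the Gamma function, which holds for negative `m` as well. -/
theorem mul_recipFactorial (c : ℂ) (m : ℤ) :
    ((m : PowerSeries ℂ) + PowerSeries.C c * .X) * recipFactorial c m =
      recipFactorial c (m - 1) := by
  rcases m with (_ | m) | m
  · rw [show Int.ofNat 0 - 1 = Int.negSucc 0 from rfl]
    simp [recipFactorial]
  · have h1 := prod_mul_recipFactorial c (m + 1)
    have h2 := prod_mul_recipFactorial c m
    rw [Finset.prod_range_succ] at h1
    have h0 : (∏ j ∈ Finset.range m, ((j : PowerSeries ℂ) + 1 + PowerSeries.C c * .X)) ≠ 0 :=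
      left_ne_zero_of_mul_eq_one h2
    have hm : (Int.ofNat (m + 1) - 1 : ℤ) = (m : ℤ) := by simp
    rw [hm]
    refine mul_left_cancel₀ h0 ?_
    refine Eq.trans ?_ (h1.trans h2.symm)
    rw [Int.ofNat_eq_natCast, Int.cast_natCast, Nat.cast_succ, mul_assoc]
  · have hm : (Int.negSucc m - 1 : ℤ) = Int.negSucc (m + 1) := by
      rw [Int.negSucc_eq, Int.negSucc_eq]; push_cast; ring
    rw [hm]
    simp only [recipFactorial]
    rw [Finset.prod_range_succ _ (m + 1), Int.negSucc_eq]
    push_cast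
    ring

theorem X_dvd_recipFactorial (c : ℂ) {m : ℤ} (hm : m < 0) :
    PowerSeries.X ∣ recipFactorial c m := by
  obtain ⟨m, rfl⟩ := Int.eq_negSucc_of_lt_zero hm
  exact (Dvd.intro_left (PowerSeries.C c) (by simp)).trans
    (Finset.dvd_prod_of_mem _ (Finset.mem_range.2 m.succ_pos))

/-- The power series of `binomial (n, k - t) / (binomial (0, -t))` in `t`, for all integers `k`. -/
noncomputable def shiftedChoose (n : ℕ) (k : ℤ) : PowerSeries ℂ :=
  (n.factorial : PowerSeries ℂ) * (recipFactorial (-1) k * recipFactorial 1 (n - k))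

theorem shiftedChoose_succ_left (n : ℕ) (k : ℤ) :
    ((n : PowerSeries ℂ) + 1 - ((k : PowerSeries ℂ) - .X)) * shiftedChoose (n + 1) k =
      ((n : PowerSeries ℂ) + 1) * shiftedChoose n k := by
  have h := mul_recipFactorial 1 ((n : ℤ) + 1 - k)
  rw [show (n : ℤ) + 1 - k - 1 = n - k by ring] at h
  simp only [shiftedChoose, Nat.factorial_succ]
  push_cast at h ⊢
  rw [← h, map_one]
  ring

theorem shiftedChoose_succ_right (n : ℕ) (k : ℤ) :
    ((k : PowerSeries ℂ) - .X + 1) * shiftedChoose n (k + 1) =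
      ((n : PowerSeries ℂ) - ((k : PowerSeries ℂ) - .X)) * shiftedChoose n k := by
  have h1 := mul_recipFactorial (-1) (k + 1)
  have h2 := mul_recipFactorial 1 ((n : ℤ) - k)
  rw [show k + 1 - 1 = k by ring] at h1
  rw [show (n : ℤ) - k - 1 = n - (k + 1) by ring] at h2
  simp only [shiftedChoose]
  rw [← h1, ← h2]
  simp only [map_neg, map_one]
  push_cast
  ring

theorem X_dvd_shiftedChoose (n : ℕ) {k : ℤ} (hk : k < 0 ∨ (n : ℤ) < k) :
    PowerSeries.X ∣ shiftedChoose n k := by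
  unfold shiftedChoose
  rcases hk with hk | hk
  · exact ((X_dvd_recipFactorial _ hk).mul_right _).mul_left _
  · exact ((X_dvd_recipFactorial _ (by omega)).mul_left _).mul_left _

/-- Both kinds of factors of `franelWeight` occur here, for `c = -1` and `c = 1`. -/
theorem factorial_mul_prod (c : ℚ) (m : ℕ) :
    (∏ j ∈ Finset.range m, ((j : PowerSeries ℂ) + 1 + PowerSeries.C (c : ℂ) * .X)) =
      (m.factorial : PowerSeries ℂ) * PowerSeries.map (algebraMap ℚ ℂ)
        (∏ j ∈ Finset.Icc 1 m, (1 + PowerSeries.C (c / (j : ℚ)) * PowerSeries.X)) := by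
  induction m with
  | zero => simp
  | succ m ih =>
    have hm : (m : ℂ) + 1 ≠ 0 := Nat.cast_add_one_ne_zero m
    have h : ((m : PowerSeries ℂ) + 1) * PowerSeries.C ((c : ℂ) / ((m : ℂ) + 1)) =
        PowerSeries.C (c : ℂ) := by
      rw [← map_natCast (PowerSeries.C (R := ℂ)) m, ← map_one (PowerSeries.C (R := ℂ)), ← map_add,
        ← map_mul, mul_div_cancel₀ _ hm]
    rw [Finset.prod_range_succ, Finset.prod_Icc_succ_top (by omega), ih, Nat.factorial_succ,
      map_mul, map_add, map_mul, PowerSeries.map_C, PowerSeries.map_X, map_one, ← h]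
    push_cast
    simp
    ring

theorem franelWeight_mul_inv (n k : ℕ) : franelWeight n k * (franelWeight n k)⁻¹ = 1 :=
  PowerSeries.mul_inv_cancel _ (by simp [constantCoeff_franelWeight])

/-- Inside the range of summation, `shiftedChoose` is the weighted binomial coefficient. -/
theorem shiftedChoose_natCast {n k : ℕ} (hk : k ≤ n) :
    shiftedChoose n k = PowerSeries.map (algebraMap ℚ ℂ)
      (PowerSeries.C (n.choose k : ℚ) * (franelWeight n k)⁻¹) := by
  have h1 := prod_mul_recipFactorial (-1) k
  have h2 := prod_mul_recipFactorial 1 (n - k)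
  have h3 := congrArg (PowerSeries.map (algebraMap ℚ ℂ)) (franelWeight_mul_inv n k)
  have e1 := factorial_mul_prod (-1) k
  have e2 := factorial_mul_prod 1 (n - k)
  have hw : franelWeight n k =
      (∏ j ∈ Finset.Icc 1 k, (1 + PowerSeries.C ((-1) / (j : ℚ)) * PowerSeries.X)) *
        ∏ j ∈ Finset.Icc 1 (n - k), (1 + PowerSeries.C (1 / (j : ℚ)) * PowerSeries.X) := by
    simp [franelWeight, neg_div, sub_eq_add_neg]
  rw [map_mul, map_one] at h3
  nth_rewrite 1 [hw] at h3
  rw [map_mul] at h3 ⊢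
  push_cast at e1 e2
  rw [e1] at h1
  rw [e2] at h2
  have hc : ((n.factorial : ℕ) : PowerSeries ℂ) = PowerSeries.map (algebraMap ℚ ℂ)
      (PowerSeries.C (n.choose k : ℚ)) * (k.factorial : PowerSeries ℂ) *
        ((n - k).factorial : PowerSeries ℂ) := by
    rw [← Nat.choose_mul_factorial_mul_factorial hk]
    simp
  rw [shiftedChoose, show (n : ℤ) - k = (n - k : ℕ) by omega, hc]
  set a := PowerSeries.map (algebraMap ℚ ℂ)
    (∏ j ∈ Finset.Icc 1 k, (1 + PowerSeries.C ((-1) / (j : ℚ)) * PowerSeries.X))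
  set b := PowerSeries.map (algebraMap ℚ ℂ)
    (∏ j ∈ Finset.Icc 1 (n - k), (1 + PowerSeries.C (1 / (j : ℚ)) * PowerSeries.X))
  set w := PowerSeries.map (algebraMap ℚ ℂ) (franelWeight n k)⁻¹
  set d := PowerSeries.map (algebraMap ℚ ℂ) (PowerSeries.C (n.choose k : ℚ))
  set r := recipFactorial (-1) k
  set r' := recipFactorial 1 (n - k : ℕ)
  set p := (k.factorial : PowerSeries ℂ)
  set q := ((n - k).factorial : PowerSeries ℂ)
  linear_combination (-d * p * q * r * r') * h3 + d * w * q * b * r' * h1 + d * w * h2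

/-! ### Parity -/

theorem rescale_neg_one_C (a : ℚ) :
    PowerSeries.rescale (-1) (PowerSeries.C a) = PowerSeries.C a := by
  ext i
  rcases i with _ | i <;> simp [PowerSeries.coeff_rescale, PowerSeries.coeff_C]

theorem rescale_inv_franelWeight {n k : ℕ} (hk : k ≤ n) :
    PowerSeries.rescale (-1) (franelWeight n k)⁻¹ = (franelWeight n (n - k))⁻¹ := by
  rw [PowerSeries.eq_inv_iff_mul_eq_one (by simp [constantCoeff_franelWeight])]
  have h : franelWeight n (n - k) = PowerSeries.rescale (-1) (franelWeight n k) := by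
    simp [franelWeight, Nat.sub_sub_self hk, PowerSeries.rescale_X, rescale_neg_one_C,
      ← sub_eq_add_neg, mul_comm]
  rw [h, ← map_mul, mul_comm, franelWeight_mul_inv, map_one]

/-- The reflection `k ↦ n - k` replaces `t` by `-t`. -/
theorem rescale_franelSeries (s n : ℕ) :
    PowerSeries.rescale (-1) (franelSeries s n) = franelSeries s n := by
  unfold franelSeries
  rw [map_sum, ← Finset.sum_range_reflect]
  refine Finset.sum_congr rfl fun k hk => ?_
  have hk' : k ≤ n := Nat.lt_succ_iff.1 (Finset.mem_range.1 hk)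
  rw [map_mul, map_pow (PowerSeries.rescale (-1 : ℚ)) (_⁻¹), show n + 1 - 1 - k = n - k by omega,
    rescale_inv_franelWeight (Nat.sub_le n k), Nat.sub_sub_self hk', Nat.choose_symm hk',
    rescale_neg_one_C]

theorem coeff_odd_franelSeries (s n i : ℕ) :
    PowerSeries.coeff (2 * i + 1) (franelSeries s n) = 0 := by
  have h := congrArg (PowerSeries.coeff (2 * i + 1)) (rescale_franelSeries s n)
  rw [PowerSeries.coeff_rescale, pow_succ, pow_mul] at h
  norm_num at h
  linarith

/-! ### Telescoping the shifted sums -/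

/-- Terms outside the natural range of summation are divisible by `t ^ s`. -/
theorem X_pow_dvd_sum_shiftedChoose_sub (s m A B : ℕ) :
    PowerSeries.X ^ s ∣
      (∑ l ∈ Finset.range (A + (m + 1) + B), shiftedChoose m ((l : ℤ) - A) ^ s) -
        PowerSeries.map (algebraMap ℚ ℂ) (franelSeries s m) := by
  rw [Finset.sum_range_add, Finset.sum_range_add]
  have h : ∑ l ∈ Finset.range (m + 1), shiftedChoose m (((A + l : ℕ) : ℤ) - A) ^ s =
      PowerSeries.map (algebraMap ℚ ℂ) (franelSeries s m) := by
    unfold franelSeries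
    rw [map_sum]
    refine Finset.sum_congr rfl fun k hk => ?_
    rw [show ((A + k : ℕ) : ℤ) - A = k by omega,
      shiftedChoose_natCast (Nat.lt_succ_iff.1 (Finset.mem_range.1 hk)), ← map_pow, mul_pow,
      ← map_pow]
  rw [h, add_right_comm, add_sub_cancel_right]
  refine dvd_add (Finset.dvd_sum fun l hl => ?_) (Finset.dvd_sum fun l _ => ?_)
  · refine pow_dvd_pow_of_dvd (X_dvd_shiftedChoose m (Or.inl ?_)) s
    have := Finset.mem_range.1 hl
    omega
  · exact pow_dvd_pow_of_dvd (X_dvd_shiftedChoose m (Or.inr (by omega))) s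

/-- Telescoping with the denominators `v` of the certificate cleared. -/
theorem mul_sum_eq_of_telescoping {R : Type*} [CommRing R] [IsDomain R] {T u v f : ℕ → R}
    (hv : ∀ l, v l ≠ 0)
    (h : ∀ l, v l * v (l + 1) * T l = u (l + 1) * v l * f (l + 1) - u l * v (l + 1) * f l)
    (L : ℕ) :
    v 0 * v L * ∑ l ∈ Finset.range L, T l = u L * v 0 * f L - u 0 * v L * f 0 := by
  induction L with
  | zero => simp [mul_comm]
  | succ L ih =>
    refine mul_left_cancel₀ (hv L) ?_
    rw [Finset.sum_range_succ]
    linear_combination v (L + 1) * ih + v 0 * h L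

/-- A nonzero polynomial in `k` has nonzero value at `k - t`, as `t` is transcendental. -/
theorem eval₂_sub_X_ne_zero {p : ℂ[X]} (hp : p ≠ 0) (k : ℤ) :
    p.eval₂ PowerSeries.C ((k : PowerSeries ℂ) - .X) ≠ 0 := by
  have h : p.eval₂ PowerSeries.C ((k : PowerSeries ℂ) - .X) =
      ((p.comp ((k : ℂ[X]) - X) : ℂ[X]) : PowerSeries ℂ) := by
    have := Polynomial.hom_eval₂ p C (coeToPowerSeries.ringHom (R := ℂ)) ((k : ℂ[X]) - X)
    rw [Polynomial.comp, ← Polynomial.coeToPowerSeries.ringHom_apply, this]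
    congr 1
    · ext a : 1
      simp
    · rw [map_sub, map_intCast]
      simp
  rw [h]
  intro h0
  rw [Polynomial.coe_eq_zero_iff, Polynomial.comp_eq_zero_iff] at h0
  rcases h0 with h0 | ⟨-, h0⟩
  · exact hp h0
  · have := congrArg (fun q : ℂ[X] => q.coeff 1) h0
    simp only [coeff_sub, coeff_X_one, ← map_intCast (C (R := ℂ)), coeff_C] at this
    norm_num at this

theorem constantCoeff_eval₂_sub_X (p : ℂ[X]) (k : ℤ) :
    PowerSeries.constantCoeff (p.eval₂ PowerSeries.C ((k : PowerSeries ℂ) - .X)) =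
      p.eval (k : ℂ) := by
  rw [Polynomial.hom_eval₂, Polynomial.eval]
  congr 1
  simp

theorem eventually_eval_natCast_ne_zero {p : ℂ[X]} (hp : p ≠ 0) :
    ∀ᶠ m : ℕ in Filter.atTop, p.eval (m : ℂ) ≠ 0 := by
  rw [← Nat.cofinite_eq_atTop]
  exact ((Polynomial.finite_setOfPred_isRoot hp).preimage
    (Nat.cast_injective (R := ℂ)).injOn).compl_mem_cofinite

/-- A telescoping operator annihilates `franelSeries s n` modulo `t ^ s`, for large `n`. -/
theorem X_pow_dvd_sum_of_isTelescopingOperator {s : ℕ} {P : ℂ[X][X]}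
    (hP : IsTelescopingOperator s P) :
    ∀ᶠ n : ℕ in Filter.atTop, PowerSeries.X ^ s ∣
      ∑ i ∈ Finset.range (P.natDegree + 1), PowerSeries.C ((P.coeff i).eval (n : ℂ)) *
        PowerSeries.map (algebraMap ℚ ℂ) (franelSeries s (n + i)) := by
  obtain ⟨U, V, hV, h⟩ := hP
  have hN := telescopingNumerator_eq_zero hV h
  -- A nonzero coefficient of `V` vanishes for finitely many `n` only.
  obtain ⟨d, hd⟩ : ∃ d, V.coeff d ≠ 0 := by
    by_contra! hc
    exact hV (Polynomial.ext hc)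
  filter_upwards [eventually_eval_natCast_ne_zero hd] with n hn
  set φ : ℂ[X] →+* PowerSeries ℂ := PowerSeries.C.comp (evalRingHom (n : ℂ)) with hφ
  set W : ℂ[X] := V.map (evalRingHom (n : ℂ)) with hW
  have hW0 : W ≠ 0 := fun h0 => hn (by
    simpa [hW] using congrArg (fun q : ℂ[X] => q.coeff d) h0)
  have hφX : φ X = (n : PowerSeries ℂ) := by simp [hφ]
  have hVW : ∀ y : PowerSeries ℂ, V.eval₂ φ y = W.eval₂ PowerSeries.C y := fun y => by
    rw [hW, Polynomial.eval₂_map]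
  -- The telescoping equation at `k - t`, for all integers `k`.
  have htel : ∀ k : ℤ, V.eval₂ φ ((k : PowerSeries ℂ) - .X) *
        V.eval₂ φ (((k + 1 : ℤ) : PowerSeries ℂ) - .X) *
          (∑ i ∈ Finset.range (P.natDegree + 1), φ (P.coeff i) * shiftedChoose (n + i) k ^ s) =
        U.eval₂ φ (((k + 1 : ℤ) : PowerSeries ℂ) - .X) * V.eval₂ φ ((k : PowerSeries ℂ) - .X) *
          shiftedChoose n (k + 1) ^ s -
        U.eval₂ φ ((k : PowerSeries ℂ) - .X) * V.eval₂ φ (((k + 1 : ℤ) : PowerSeries ℂ) - .X) *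
          shiftedChoose n k ^ s := by
    intro k
    have ht := eval₂_telescopingNumerator s P U V φ ((k : PowerSeries ℂ) - .X)
      (fun i => shiftedChoose (n + i) k) (shiftedChoose n (k + 1)) (fun i => by
        rw [hφX]
        simpa [add_assoc] using shiftedChoose_succ_left (n + i) k) (by
        rw [hφX]
        exact shiftedChoose_succ_right n k)
    have hne : ∀ m : ℤ, (m : PowerSeries ℂ) - .X ≠ 0 := fun m => by
      have := eval₂_sub_X_ne_zero (X_ne_zero (R := ℂ)) m
      rwa [eval₂_X] at this
    rw [hN, eval₂_zero, zero_mul, eq_comm, mul_eq_zero] at ht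
    have hk : (k : PowerSeries ℂ) - .X + 1 = ((k + 1 : ℤ) : PowerSeries ℂ) - .X := by
      push_cast; ring
    have ht := ht.resolve_left <| mul_ne_zero
      (pow_ne_zero _ (by rw [hk]; exact hne _))
      (pow_ne_zero _ (Finset.prod_ne_zero_iff.2 fun l _ => by
        rw [hφX]
        intro h0
        refine hne (k - n - l - 1) ?_
        push_cast
        linear_combination -h0))
    rw [hk] at ht
    exact sub_eq_zero.1 ht
  -- The sum runs over `-A ≤ k < B`, where `A` and `B` are so large that `V` does not vanish at
  -- `(n, -A)` and `(n, B)`; then both boundary terms are divisible by `t ^ s`.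
  obtain ⟨A, hA, hA1⟩ := ((eventually_eval_natCast_ne_zero (p := W.comp (-X)) (fun h0 => hW0 (by
    simpa [Polynomial.comp_assoc] using congrArg (fun q : ℂ[X] => q.comp (-X)) h0))).and
    (Filter.eventually_ge_atTop 1)).exists
  obtain ⟨B, hB, hB1⟩ := ((eventually_eval_natCast_ne_zero hW0).and
    (Filter.eventually_ge_atTop (n + P.natDegree + 1))).exists
  have hsum := mul_sum_eq_of_telescoping
    (v := fun l => V.eval₂ φ ((((l : ℤ) - A : ℤ) : PowerSeries ℂ) - .X))
    (u := fun l => U.eval₂ φ ((((l : ℤ) - A : ℤ) : PowerSeries ℂ) - .X))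
    (f := fun l => shiftedChoose n ((l : ℤ) - A) ^ s)
    (T := fun l => ∑ i ∈ Finset.range (P.natDegree + 1),
      φ (P.coeff i) * shiftedChoose (n + i) ((l : ℤ) - A) ^ s)
    (fun l => by rw [hVW]; exact eval₂_sub_X_ne_zero hW0 _)
    (fun l => by
      have h1 : (((l + 1 : ℕ) : ℤ) - A) = ((l : ℤ) - A) + 1 := by push_cast; ring
      simp only [h1]
      exact htel ((l : ℤ) - A)) (A + B)
  have hunit : IsUnit (V.eval₂ φ (((((0 : ℕ) : ℤ) - A : ℤ) : PowerSeries ℂ) - .X) *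
      V.eval₂ φ (((((A + B : ℕ) : ℤ) - A : ℤ) : PowerSeries ℂ) - .X)) := by
    rw [PowerSeries.isUnit_iff_constantCoeff, map_mul, hVW, hVW, constantCoeff_eval₂_sub_X,
      constantCoeff_eval₂_sub_X]
    refine (mul_ne_zero ?_ ?_).isUnit
    · simpa using hA
    · simpa using hB
  have hdvd : PowerSeries.X ^ s ∣ ∑ l ∈ Finset.range (A + B),
      ∑ i ∈ Finset.range (P.natDegree + 1),
        φ (P.coeff i) * shiftedChoose (n + i) ((l : ℤ) - A) ^ s := by
    rw [← hunit.dvd_mul_left, hsum]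
    exact dvd_sub
      ((pow_dvd_pow_of_dvd (X_dvd_shiftedChoose n (Or.inr (by push_cast; omega))) s).mul_left _)
      ((pow_dvd_pow_of_dvd (X_dvd_shiftedChoose n (Or.inl (by push_cast; omega))) s).mul_left _)
  rw [Finset.sum_comm] at hdvd
  refine (dvd_sub_right hdvd).1 ?_
  rw [← Finset.sum_sub_distrib]
  refine Finset.dvd_sum fun i hi => ?_
  have hi' := Finset.mem_range.1 hi
  rw [← Finset.mul_sum]
  change _ ∣ PowerSeries.C ((P.coeff i).eval (n : ℂ)) * _ - _
  rw [← mul_sub]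
  have := X_pow_dvd_sum_shiftedChoose_sub s (n + i) A (B - (n + i + 1))
  rw [show A + (n + i + 1) + (B - (n + i + 1)) = A + B by omega] at this
  exact this.mul_left _

theorem recurrenceApply_franelCoeff_eq_zero {s : ℕ} (hs : 0 < s) {P : ℂ[X][X]}
    (hP : IsTelescopingOperator s P) :
    ∃ n₀ : ℕ, ∀ n ≥ n₀, ∀ j ≤ (s - 1) / 2,
      recurrenceApply P (fun m => (franelCoeff s j m : ℂ)) n = 0 := by
  obtain ⟨n₀, h⟩ := Filter.eventually_atTop.1 (X_pow_dvd_sum_of_isTelescopingOperator hP)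
  refine ⟨n₀, fun n hn j hj => ?_⟩
  have h0 := PowerSeries.X_pow_dvd_iff.1 (h n hn) (2 * j) (by omega)
  rw [recurrenceApply_eq_sum, ← h0, map_sum]
  simp [franelCoeff]

/-! ### Taylor coefficients in Euler's sine product -/

/-- If polynomials converge to `g` locally uniformly, then their coefficients converge to the Taylor
coefficients of `g` at `0`. -/
theorem tendsto_coeff_of_tendstoLocallyUniformlyOn {F : ℕ → ℂ[X]} {g : ℂ → ℂ}
    (h : TendstoLocallyUniformlyOn (fun k z => (F k).eval z) g Filter.atTop Set.univ) (m : ℕ) :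
    Filter.Tendsto (fun k => (m.factorial : ℂ) * (F k).coeff m) Filter.atTop
      (nhds (iteratedDeriv m g 0)) := by
  have key : TendstoLocallyUniformlyOn (fun k z => (derivative^[m] (F k)).eval z)
      (iteratedDeriv m g) Filter.atTop Set.univ := by
    induction m with
    | zero => simpa using h
    | succ m ih =>
      have := ih.deriv (Filter.Eventually.of_forall fun k =>
        (Polynomial.differentiable _).differentiableOn) isOpen_univ
      rw [iteratedDeriv_succ]
      refine this.congr fun k z _ => ?_
      rw [Function.comp_apply, Function.iterate_succ_apply', Polynomial.deriv]
  refine (key.tendsto_at (Set.mem_univ 0)).congr fun k => ?_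
  rw [← Polynomial.coeff_zero_eq_eval_zero, Polynomial.coeff_iterate_derivative, zero_add,
    Nat.descFactorial_self, nsmul_eq_mul]

/-- The partial products of Euler's product for `sin (π t) / (π t)`. -/
noncomputable def eulerSeries (k : ℕ) : PowerSeries ℝ :=
  ∏ j ∈ Finset.Icc 1 k, (1 - PowerSeries.C (1 / (j : ℝ) ^ 2) * PowerSeries.X ^ 2)

theorem tendstoLocallyUniformlyOn_euler_sin_prod :
    TendstoLocallyUniformlyOn
      (fun (k : ℕ) (z : ℂ) =>
        (Real.pi * z) * ∏ j ∈ Finset.range k, (1 + -z ^ 2 / ((j : ℂ) + 1) ^ 2))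
      (fun z => Complex.sin (Real.pi * z)) Filter.atTop Set.univ := by
  have h1 : TendstoLocallyUniformlyOn
      (fun (k : ℕ) (z : ℂ) => ∏ j ∈ Finset.range k, (1 + -z ^ 2 / ((j : ℂ) + 1) ^ 2))
      (fun z => ∏' j : ℕ, (1 + sineTerm z j)) Filter.atTop Set.univ := by
    rw [tendstoLocallyUniformlyOn_iff_forall_isCompact isOpen_univ]
    intro K _ hK
    exact (multipliableUniformlyOn_euler_sin_prod_on_compact
      hK).hasProdUniformlyOn.tendstoUniformlyOn_finsetRange
  have h1c := h1.continuousOn (Filter.Frequently.of_forall fun k => by fun_prop)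
  have h2 : TendstoLocallyUniformlyOn (fun (_ : ℕ) (z : ℂ) => (Real.pi * z : ℂ))
      (fun z => (Real.pi * z : ℂ)) Filter.atTop Set.univ := by
    intro u hu x _
    exact ⟨Set.univ, Filter.univ_mem,
      Filter.Eventually.of_forall fun _ _ _ => refl_mem_uniformity hu⟩
  have h3 := h2.mul₀ h1 (by fun_prop) h1c
  refine h3.congr_right fun z _ => ?_
  -- Where `z = 0`, the infinite product is not `sin (π z) / (π z)`, but the products with
  -- `π z` agree.
  exact tendsto_nhds_unique (h3.tendsto_at (Set.mem_univ z))
    ((Complex.tendsto_euler_sin_prod z).congr fun k => by simp [sub_eq_add_neg, neg_div])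

theorem coeff_sin_eq_iteratedDeriv (m : ℕ) :
    (m.factorial : ℂ) * ((PowerSeries.coeff m (PowerSeries.sin ℚ) : ℚ) : ℂ) =
      iteratedDeriv m Complex.sin 0 := by
  rcases Nat.even_or_odd' m with ⟨i, rfl | rfl⟩
  · simp [PowerSeries.sin]
  · have : ((2 * i + 1).factorial : ℂ) ≠ 0 := Nat.cast_ne_zero.2 (Nat.factorial_ne_zero _)
    rw [Complex.iteratedDeriv_odd_sin]
    simp [PowerSeries.sin, show (2 * i + 1) / 2 = i by omega]
    field_simp

theorem tendsto_coeff_eulerSeries (m : ℕ) :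
    Filter.Tendsto (fun k => PowerSeries.coeff m (eulerSeries k)) Filter.atTop
      (nhds (Real.pi ^ m * (PowerSeries.coeff m sinDivX : ℚ))) := by
  set F : ℕ → ℂ[X] := fun k => C (Real.pi : ℂ) * X *
    ∏ j ∈ Finset.range k, (1 - C (1 / ((j : ℂ) + 1) ^ 2) * X ^ 2) with hF
  have h := tendsto_coeff_of_tendstoLocallyUniformlyOn (F := F)
    (tendstoLocallyUniformlyOn_euler_sin_prod.congr fun k z _ => by
      simp only [hF, eval_mul, eval_C, eval_X, eval_prod, eval_sub, eval_one, eval_pow]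
      congr 1
      refine Finset.prod_congr rfl fun j _ => ?_
      ring) (m + 1)
  have hcoe : ∀ k, (F k : PowerSeries ℂ) = PowerSeries.C (Real.pi : ℂ) * PowerSeries.X *
      PowerSeries.map Complex.ofRealHom (eulerSeries k) := by
    intro k
    have hprod : ((∏ j ∈ Finset.range k, (1 - C (1 / ((j : ℂ) + 1) ^ 2) * X ^ 2) : ℂ[X]) :
        PowerSeries ℂ) = PowerSeries.map Complex.ofRealHom (eulerSeries k) := by
      unfold eulerSeries
      induction k with
      | zero => simp
      | succ k ih =>
        rw [Finset.prod_range_succ, Finset.prod_Icc_succ_top (by omega), Polynomial.coe_mul, ih,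
          map_mul, Polynomial.coe_sub]
        simp
    rw [hF, Polynomial.coe_mul, hprod, Polynomial.coe_mul, Polynomial.coe_C, Polynomial.coe_X]
  have hc : ∀ k, (F k).coeff (m + 1) =
      ((Real.pi * PowerSeries.coeff m (eulerSeries k) : ℝ) : ℂ) := by
    intro k
    rw [← Polynomial.coeff_coe, hcoe, mul_assoc, PowerSeries.coeff_C_mul,
      PowerSeries.coeff_succ_X_mul, PowerSeries.coeff_map]
    simp
  have hsin : PowerSeries.coeff (m + 1) (PowerSeries.sin ℚ) = PowerSeries.coeff m sinDivX := by
    rw [← X_mul_sinDivX, PowerSeries.coeff_succ_X_mul]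
  rw [iteratedDeriv_comp_const_mul Complex.contDiff_sin] at h
  beta_reduce at h
  rw [mul_zero, ← coeff_sin_eq_iteratedDeriv, hsin] at h
  have hfac : ((m + 1).factorial : ℂ) ≠ 0 := Nat.cast_ne_zero.2 (Nat.factorial_ne_zero _)
  have hpi : (Real.pi : ℂ) ≠ 0 := Complex.ofReal_ne_zero.2 Real.pi_ne_zero
  have h' := h.const_mul (((m + 1).factorial : ℂ) * Real.pi)⁻¹
  rw [Complex.isometry_ofReal.isEmbedding.tendsto_nhds_iff]
  convert h' using 2
  · rw [Function.comp_apply, hc, Complex.ofReal_mul, ← mul_assoc (Nat.cast _),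
      inv_mul_cancel_left₀ (mul_ne_zero hfac hpi)]
  · push_cast
    rw [pow_succ, mul_inv, mul_comm _ (Real.pi : ℂ)]
    generalize ((m + 1).factorial : ℂ) = a at hfac
    field_simp

/-! ### Coefficientwise convergence of power series -/

/-- Inversion of power series is continuous for coefficientwise convergence. -/
theorem tendsto_coeff_inv {ι : Type*} {l : Filter ι} {f : ι → PowerSeries ℝ} {g : PowerSeries ℝ}
    (h : ∀ m, Filter.Tendsto (fun i => PowerSeries.coeff m (f i)) l (nhds (PowerSeries.coeff m g)))
    (hg : PowerSeries.constantCoeff g ≠ 0) (m : ℕ) :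
    Filter.Tendsto (fun i => PowerSeries.coeff m (f i)⁻¹) l
      (nhds (PowerSeries.coeff m g⁻¹)) := by
  have h0 : Filter.Tendsto (fun i => (PowerSeries.constantCoeff (f i))⁻¹) l
      (nhds (PowerSeries.constantCoeff g)⁻¹) := by
    simpa using (h 0).inv₀ (by simpa using hg)
  induction m using Nat.strong_induction_on with
  | _ m ih =>
    refine Filter.Tendsto.congr (fun i => (PowerSeries.coeff_inv m (f i)).symm) ?_
    rw [PowerSeries.coeff_inv m g]
    split_ifs with hm
    · exact h0
    · refine h0.neg.mul (tendsto_finsetSum _ fun x _ => ?_)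
      split_ifs with hx
      · exact (h x.1).mul (ih x.2 hx)
      · exact tendsto_const_nhds

theorem tendsto_coeff_mul {ι : Type*} {l : Filter ι} {f f' : ι → PowerSeries ℝ}
    {g g' : PowerSeries ℝ}
    (h : ∀ m, Filter.Tendsto (fun i => PowerSeries.coeff m (f i)) l (nhds (PowerSeries.coeff m g)))
    (h' : ∀ m, Filter.Tendsto (fun i => PowerSeries.coeff m (f' i)) l
      (nhds (PowerSeries.coeff m g'))) (m : ℕ) :
    Filter.Tendsto (fun i => PowerSeries.coeff m (f i * f' i)) l
      (nhds (PowerSeries.coeff m (g * g'))) := by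
  simp only [PowerSeries.coeff_mul]
  exact tendsto_finsetSum _ fun x _ => (h x.1).mul (h' x.2)

theorem tendsto_coeff_pow {ι : Type*} {l : Filter ι} {f : ι → PowerSeries ℝ} {g : PowerSeries ℝ}
    (h : ∀ m, Filter.Tendsto (fun i => PowerSeries.coeff m (f i)) l (nhds (PowerSeries.coeff m g)))
    (s m : ℕ) :
    Filter.Tendsto (fun i => PowerSeries.coeff m (f i ^ s)) l
      (nhds (PowerSeries.coeff m (g ^ s))) := by
  induction s generalizing m with
  | zero => simpa using tendsto_const_nhds
  | succ s ih =>
    simp only [pow_succ]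
    exact tendsto_coeff_mul ih h m

/-! ### Geometric bounds for coefficients -/

/-- The power series `f` is majorized by the geometric series `1 / (1 - a t)`. -/
def GeometricBound (a : ℝ) (f : PowerSeries ℝ) : Prop :=
  ∀ m, |PowerSeries.coeff m f| ≤ a ^ m

theorem GeometricBound.mono {a b : ℝ} {f : PowerSeries ℝ} (hf : GeometricBound a f) (ha : 0 ≤ a)
    (hab : a ≤ b) : GeometricBound b f := fun m =>
  (hf m).trans (pow_le_pow_left₀ ha hab m)

theorem geometricBound_one : GeometricBound 0 1 := fun m => by
  rcases m with _ | m <;> simp [PowerSeries.coeff_one]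

/-- The bound is the binomial theorem, with each binomial coefficient at least `1`. -/
theorem GeometricBound.mul {a b : ℝ} {f g : PowerSeries ℝ} (ha : 0 ≤ a) (hb : 0 ≤ b)
    (hf : GeometricBound a f) (hg : GeometricBound b g) : GeometricBound (a + b) (f * g) := by
  intro m
  rw [PowerSeries.coeff_mul, (Commute.all a b).add_pow']
  refine (Finset.abs_sum_le_sum_abs _ _).trans (Finset.sum_le_sum fun x hx => ?_)
  rw [abs_mul, nsmul_eq_mul]
  have h1 : (1 : ℝ) ≤ m.choose x.1 := by
    exact_mod_cast Nat.choose_pos ((Nat.le_add_right _ _).trans_eq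
      (Finset.HasAntidiagonal.mem_antidiagonal.1 hx))
  have h2 : |PowerSeries.coeff x.1 f| * |PowerSeries.coeff x.2 g| ≤ a ^ x.1 * b ^ x.2 :=
    mul_le_mul (hf _) (hg _) (abs_nonneg _) (pow_nonneg ha _)
  exact h2.trans (le_mul_of_one_le_left (by positivity) h1)

theorem GeometricBound.prod {ι : Type*} (S : Finset ι) {a : ι → ℝ} {f : ι → PowerSeries ℝ}
    (ha : ∀ i, 0 ≤ a i) (hf : ∀ i ∈ S, GeometricBound (a i) (f i)) :
    GeometricBound (∑ i ∈ S, a i) (∏ i ∈ S, f i) := by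
  classical
  induction S using Finset.induction_on with
  | empty => simpa using geometricBound_one
  | insert i S hi ih =>
    rw [Finset.sum_insert hi, Finset.prod_insert hi]
    exact (hf i (Finset.mem_insert_self i S)).mul (ha i) (Finset.sum_nonneg fun _ _ => ha _)
      (ih fun j hj => hf j (Finset.mem_insert_of_mem hj))

theorem GeometricBound.pow {a : ℝ} {f : PowerSeries ℝ} (ha : 0 ≤ a) (hf : GeometricBound a f)
    (s : ℕ) : GeometricBound (s * a) (f ^ s) := by
  simpa using GeometricBound.prod (Finset.range s) (a := fun _ => a) (fun _ => ha)
    (fun _ _ => hf)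

theorem inv_one_add_C_mul_X (a : ℝ) :
    (1 + PowerSeries.C a * PowerSeries.X)⁻¹ = PowerSeries.mk fun m => (-a) ^ m := by
  rw [eq_comm, PowerSeries.eq_inv_iff_mul_eq_one (by simp), mul_comm]
  ext m
  rw [add_mul, one_mul, mul_assoc, map_add, PowerSeries.coeff_C_mul, PowerSeries.coeff_one]
  rcases m with _ | m
  · simp
  · rw [PowerSeries.coeff_succ_X_mul]
    simp [pow_succ]
    ring

theorem geometricBound_inv_one_add (a : ℝ) :
    GeometricBound |a| (1 + PowerSeries.C a * PowerSeries.X)⁻¹ := fun m => by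
  rw [inv_one_add_C_mul_X, PowerSeries.coeff_mk, abs_pow, abs_neg]

theorem prod_inv {ι : Type*} (S : Finset ι) (f : ι → PowerSeries ℝ) :
    (∏ i ∈ S, f i)⁻¹ = ∏ i ∈ S, (f i)⁻¹ := by
  classical
  induction S using Finset.induction_on with
  | empty => simp
  | insert i S hi ih =>
    rw [Finset.prod_insert hi, Finset.prod_insert hi, PowerSeries.mul_inv_rev, ih, mul_comm]

/-! ### The reciprocal weights -/

/-- The reciprocal of `franelWeight n k`, with real coefficients. -/
noncomputable def invWeight (n k : ℕ) : PowerSeries ℝ :=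
  PowerSeries.map (algebraMap ℚ ℝ) (franelWeight n k)⁻¹

theorem map_inv_of_constantCoeff_eq_one {f : PowerSeries ℚ}
    (hf : PowerSeries.constantCoeff f = 1) :
    PowerSeries.map (algebraMap ℚ ℝ) f⁻¹ = (PowerSeries.map (algebraMap ℚ ℝ) f)⁻¹ := by
  rw [PowerSeries.eq_inv_iff_mul_eq_one (by
    rw [← PowerSeries.coeff_zero_eq_constantCoeff_apply, PowerSeries.coeff_map,
      PowerSeries.coeff_zero_eq_constantCoeff_apply, hf]; simp), ← map_mul,
    PowerSeries.inv_mul_cancel _ (by simp [hf]), map_one]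

theorem invWeight_eq (n k : ℕ) :
    invWeight n k =
      ((∏ j ∈ Finset.Icc 1 k, (1 + PowerSeries.C (-1 / (j : ℝ)) * PowerSeries.X)) *
        ∏ j ∈ Finset.Icc 1 (n - k), (1 + PowerSeries.C (1 / (j : ℝ)) * PowerSeries.X))⁻¹ := by
  rw [invWeight, map_inv_of_constantCoeff_eq_one (constantCoeff_franelWeight n k)]
  simp [franelWeight, map_prod, neg_div, sub_eq_add_neg]

theorem eulerSeries_eq (k : ℕ) :
    eulerSeries k = (∏ j ∈ Finset.Icc 1 k, (1 + PowerSeries.C (-1 / (j : ℝ)) * PowerSeries.X)) *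
        ∏ j ∈ Finset.Icc 1 k, (1 + PowerSeries.C (1 / (j : ℝ)) * PowerSeries.X) := by
  rw [← Finset.prod_mul_distrib]
  refine Finset.prod_congr rfl fun j _ => ?_
  rw [neg_div, map_neg, ← one_div_pow, map_pow]
  ring

theorem geometricBound_inv_prod (S : Finset ℕ) {c : ℝ} (hc : |c| = 1) :
    GeometricBound (∑ j ∈ S, 1 / (j : ℝ))
      (∏ j ∈ S, (1 + PowerSeries.C (c / (j : ℝ)) * PowerSeries.X))⁻¹ := by
  rw [prod_inv]
  refine GeometricBound.prod S (fun j => by positivity) fun j _ => ?_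
  have := geometricBound_inv_one_add (c / j)
  rwa [abs_div, hc, Nat.abs_cast] at this

/-- There are `n` factors `1 ± t / j`, and the reciprocal of each is majorized by
`1 / (1 - t)`. -/
theorem geometricBound_invWeight {n k : ℕ} (hk : k ≤ n) : GeometricBound n (invWeight n k) := by
  have h (m : ℕ) : ∑ j ∈ Finset.Icc 1 m, 1 / (j : ℝ) ≤ m := by
    refine (Finset.sum_le_card_nsmul _ _ 1 fun j hj => ?_).trans (by simp)
    rw [div_le_one] <;> · norm_cast; have := (Finset.mem_Icc.1 hj).1; omega
  have h0 (m : ℕ) : 0 ≤ ∑ j ∈ Finset.Icc 1 m, 1 / (j : ℝ) :=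
    Finset.sum_nonneg fun j _ => by positivity
  rw [invWeight_eq, PowerSeries.mul_inv_rev]
  refine ((geometricBound_inv_prod (Finset.Icc 1 (n - k)) (c := 1) (by simp)).mul (h0 _) (h0 _)
    (geometricBound_inv_prod (Finset.Icc 1 k) (c := -1) (by simp))).mono
      (add_nonneg (h0 _) (h0 _)) ?_
  calc _ ≤ ((n - k : ℕ) : ℝ) + k := add_le_add (h _) (h _)
    _ = n := by rw [Nat.cast_sub hk]; ring

theorem prod_Icc_one_eq_mul {a b : ℕ} (hab : a ≤ b) (f : ℕ → PowerSeries ℝ) :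
    ∏ j ∈ Finset.Icc 1 b, f j = (∏ j ∈ Finset.Icc 1 a, f j) * ∏ j ∈ Finset.Ioc a b, f j := by
  rw [show Finset.Icc 1 b = Finset.Ioc 0 b from rfl, show Finset.Icc 1 a = Finset.Ioc 0 a from rfl,
    Finset.prod_Ioc_consecutive _ (Nat.zero_le a) hab]

/-- Matching the factors `1 - t / j` and `1 + t / j` for `j ≤ min k (n - k)` leaves a factor which
is close to `1` when `k` is close to `n / 2`. -/
theorem exists_invWeight_eq_mul {n k : ℕ} (hk : k ≤ n) :
    ∃ g : PowerSeries ℝ, PowerSeries.constantCoeff g = 1 ∧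
      GeometricBound (|2 * (k : ℝ) - n| / (min k (n - k) + 1 : ℕ)) g ∧
      invWeight n k = (eulerSeries (min k (n - k)))⁻¹ * g := by
  have hbound (a b : ℕ) (hab : a ≤ b) (c : ℝ) (hc : |c| = 1) :
      GeometricBound (((b : ℝ) - a) / (a + 1 : ℕ))
        (∏ j ∈ Finset.Ioc a b, (1 + PowerSeries.C (c / (j : ℝ)) * PowerSeries.X))⁻¹ := by
    refine (geometricBound_inv_prod _ hc).mono (Finset.sum_nonneg fun j _ => by positivity) ?_
    refine (Finset.sum_le_card_nsmul _ _ (1 / ((a + 1 : ℕ) : ℝ)) fun j hj => ?_).trans (le_of_eq ?_)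
    · exact one_div_le_one_div_of_le (by positivity)
        (Nat.cast_le.2 (Finset.mem_Ioc.1 hj).1)
    · rw [Nat.card_Ioc, nsmul_eq_mul, Nat.cast_sub hab, mul_one_div]
  have hconst (S : Finset ℕ) (c : ℝ) : PowerSeries.constantCoeff
      (∏ j ∈ S, (1 + PowerSeries.C (c / (j : ℝ)) * PowerSeries.X))⁻¹ = 1 := by
    simp [map_prod]
  rcases le_total k (n - k) with h | h
  · refine ⟨_, hconst (Finset.Ioc k (n - k)) 1, ?_, ?_⟩
    · convert hbound k (n - k) h 1 (by simp) using 2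
      · rw [abs_of_nonpos, Nat.cast_sub hk]
        · ring
        · have : 2 * k ≤ n := by omega
          have : (2 : ℝ) * k ≤ n := by exact_mod_cast this
          linarith
      · rw [min_eq_left h]
    · rw [min_eq_left h, invWeight_eq, eulerSeries_eq, prod_Icc_one_eq_mul h, ← mul_assoc,
        PowerSeries.mul_inv_rev, mul_comm]
  · refine ⟨_, hconst (Finset.Ioc (n - k) k) (-1), ?_, ?_⟩
    · convert hbound (n - k) k h (-1) (by simp) using 2
      · rw [abs_of_nonneg, Nat.cast_sub hk]
        · ring
        · have : n ≤ 2 * k := by omega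
          have : (n : ℝ) ≤ 2 * k := by exact_mod_cast this
          linarith
      · rw [min_eq_right h]
    · rw [min_eq_right h, invWeight_eq, eulerSeries_eq, prod_Icc_one_eq_mul h, mul_right_comm,
        PowerSeries.mul_inv_rev, mul_comm]

/-- The power series `(π t) / sin (π t)`. -/
noncomputable def divSinPi : PowerSeries ℝ :=
  PowerSeries.rescale Real.pi (PowerSeries.map (algebraMap ℚ ℝ) sinDivX⁻¹)

theorem tendsto_coeff_inv_eulerSeries (m : ℕ) :
    Filter.Tendsto (fun k => PowerSeries.coeff m (eulerSeries k)⁻¹) Filter.atTop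
      (nhds (PowerSeries.coeff m divSinPi)) := by
  have hc : PowerSeries.constantCoeff
      (PowerSeries.rescale Real.pi (PowerSeries.map (algebraMap ℚ ℝ) sinDivX)) ≠ 0 := by
    rw [← PowerSeries.coeff_zero_eq_constantCoeff_apply, PowerSeries.coeff_rescale,
      PowerSeries.coeff_map, PowerSeries.coeff_zero_eq_constantCoeff_apply, constantCoeff_sinDivX]
    simp
  have h : divSinPi =
      (PowerSeries.rescale Real.pi (PowerSeries.map (algebraMap ℚ ℝ) sinDivX))⁻¹ := by
    rw [PowerSeries.eq_inv_iff_mul_eq_one hc, divSinPi, ← map_mul, ← map_mul,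
      PowerSeries.inv_mul_cancel _ (by simp [constantCoeff_sinDivX]), map_one, map_one]
  rw [h]
  refine tendsto_coeff_inv (fun m => ?_) hc m
  rw [PowerSeries.coeff_rescale, PowerSeries.coeff_map]
  exact tendsto_coeff_eulerSeries m

theorem coeff_divSinPi_pow (s j : ℕ) :
    PowerSeries.coeff (2 * j) (divSinPi ^ s) = (sinCoeff s j : ℝ) * Real.pi ^ (2 * j) := by
  rw [divSinPi, ← map_pow, ← map_pow, PowerSeries.coeff_rescale, PowerSeries.coeff_map, sinCoeff,
    mul_comm]
  rfl

/-- Along any filter on which `k / n` tends to `1 / 2`, the reciprocal weights tend to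
`π t / sin (π t)`. -/
theorem tendsto_coeff_invWeight {ι : Type*} {l : Filter ι} {n k : ι → ℕ}
    (hk : ∀ᶠ i in l, k i ≤ n i)
    (hmin : Filter.Tendsto (fun i => min (k i) (n i - k i)) l Filter.atTop)
    (hσ : Filter.Tendsto (fun i => |2 * (k i : ℝ) - n i| / (min (k i) (n i - k i) + 1 : ℕ)) l
      (nhds 0)) (m : ℕ) :
    Filter.Tendsto (fun i => PowerSeries.coeff m (invWeight (n i) (k i))) l
      (nhds (PowerSeries.coeff m divSinPi)) := by
  have hex (i : ι) : ∃ g : PowerSeries ℝ, k i ≤ n i → PowerSeries.constantCoeff g = 1 ∧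
      GeometricBound (|2 * (k i : ℝ) - n i| / (min (k i) (n i - k i) + 1 : ℕ)) g ∧
      invWeight (n i) (k i) = (eulerSeries (min (k i) (n i - k i)))⁻¹ * g := by
    by_cases h : k i ≤ n i
    · obtain ⟨g, hg⟩ := exists_invWeight_eq_mul h
      exact ⟨g, fun _ => hg⟩
    · exact ⟨0, fun h' => absurd h' h⟩
  choose g hg using hex
  have hg1 (m : ℕ) : Filter.Tendsto (fun i => PowerSeries.coeff m (g i)) l
      (nhds (PowerSeries.coeff m 1)) := by
    rcases m with _ | m
    · refine tendsto_const_nhds.congr' ?_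
      filter_upwards [hk] with i hi
      simp [(hg i hi).1]
    · rw [PowerSeries.coeff_one, if_neg (Nat.succ_ne_zero m)]
      have h0 := hσ.pow (m + 1)
      rw [zero_pow (Nat.succ_ne_zero m)] at h0
      refine squeeze_zero_norm' ?_ h0
      filter_upwards [hk] with i hi
      exact (hg i hi).2.1 (m + 1)
  have := tendsto_coeff_mul (fun m => (tendsto_coeff_inv_eulerSeries m).comp hmin) hg1 m
  rw [mul_one] at this
  refine this.congr' ?_
  filter_upwards [hk] with i hi
  rw [(hg i hi).2.2]

/-! ### Central terms -/

/-- The distance of `k / n` from `1 / 2`, doubled, for the pair `(n, k)`. -/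
noncomputable def offCenter (p : ℕ × ℕ) : ℝ := |2 * (p.2 : ℝ) - p.1| / p.1

/-- The filter of pairs `(n, k)` with `n → ∞` and `k / n → 1 / 2`. -/
noncomputable def centralFilter : Filter (ℕ × ℕ) :=
  Filter.comap Prod.fst Filter.atTop ⊓ Filter.comap offCenter (nhds 0)

theorem tendsto_coeff_invWeight_pow (s m : ℕ) :
    Filter.Tendsto (fun p : ℕ × ℕ => PowerSeries.coeff m (invWeight p.1 p.2 ^ s)) centralFilter
      (nhds (PowerSeries.coeff m (divSinPi ^ s))) := by
  have hn : Filter.Tendsto (fun p : ℕ × ℕ => p.1) centralFilter Filter.atTop :=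
    Filter.tendsto_comap.mono_left inf_le_left
  have hr : Filter.Tendsto offCenter centralFilter (nhds 0) :=
    Filter.tendsto_comap.mono_left inf_le_right
  -- `min k (n - k) = (n - |2 * k - n|) / 2`
  have hmin (p : ℕ × ℕ) (h0 : 0 < p.1) (h1 : offCenter p < 1) : p.2 ≤ p.1 ∧
      (p.1 : ℝ) * ((1 - offCenter p) / 2) ≤ (min p.2 (p.1 - p.2) : ℕ) := by
    obtain ⟨n, k⟩ := p
    simp only [offCenter] at h0 h1 ⊢
    have hnR : (0 : ℝ) < n := Nat.cast_pos.2 h0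
    have habs : |2 * (k : ℝ) - n| < n := by rwa [div_lt_one hnR] at h1
    have hkn : k ≤ n := by
      have := (abs_lt.1 habs).2
      have : (k : ℝ) < n := by linarith
      exact_mod_cast this.le
    refine ⟨hkn, ?_⟩
    have he : (n : ℝ) * ((1 - |2 * (k : ℝ) - n| / n) / 2) = (n - |2 * (k : ℝ) - n|) / 2 := by
      field_simp
    rw [he, Nat.cast_min, Nat.cast_sub hkn, le_min_iff]
    constructor
    · linarith [neg_le_abs (2 * (k : ℝ) - n)]
    · linarith [le_abs_self (2 * (k : ℝ) - n)]
  have hev : ∀ᶠ p in centralFilter, 0 < p.1 ∧ offCenter p < 1 :=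
    (hn.eventually_gt_atTop 0).and (hr.eventually_lt_const one_pos)
  refine tendsto_coeff_pow (fun m => tendsto_coeff_invWeight ?_ ?_ ?_ m) s m
  · filter_upwards [hev] with p hp using (hmin p hp.1 hp.2).1
  · rw [← tendsto_natCast_atTop_iff (R := ℝ)]
    have h1 : Filter.Tendsto (fun p => (1 - offCenter p) / 2) centralFilter (nhds ((1 - 0) / 2)) :=
      (hr.const_sub 1).div_const 2
    refine Filter.tendsto_atTop_mono' _ ?_
      ((tendsto_natCast_atTop_atTop.comp hn).atTop_mul_pos (by norm_num) h1)
    filter_upwards [hev] with p hp using (hmin p hp.1 hp.2).2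
  · have h2 : Filter.Tendsto (fun p => offCenter p / ((1 - offCenter p) / 2)) centralFilter
        (nhds (0 / ((1 - 0) / 2))) := hr.div ((hr.const_sub 1).div_const 2) (by norm_num)
    rw [zero_div] at h2
    refine squeeze_zero' (Filter.Eventually.of_forall fun p => by positivity) ?_ h2
    filter_upwards [hev] with p hp
    have h3 := (hmin p hp.1 hp.2).2
    have hnR : (0 : ℝ) < p.1 := Nat.cast_pos.2 hp.1
    have h4 : 0 < (1 - offCenter p) / 2 := by linarith [hp.2]
    have h5 : offCenter p = |2 * (p.2 : ℝ) - p.1| / p.1 := rfl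
    calc |2 * (p.2 : ℝ) - p.1| / (min p.2 (p.1 - p.2) + 1 : ℕ)
        ≤ |2 * (p.2 : ℝ) - p.1| / (p.1 * ((1 - offCenter p) / 2)) := by
          refine div_le_div_of_nonneg_left (abs_nonneg _) (mul_pos hnR h4) (h3.trans ?_)
          exact_mod_cast Nat.le_succ _
      _ = offCenter p / ((1 - offCenter p) / 2) := by rw [← div_div, ← h5]

/-! ### Concentration of the sum near its central terms -/

/-- Chernoff's bound for the tails of the binomial distribution. -/
theorem choose_le_exp_of_offCenter {n k : ℕ} (hk : k ≤ n) {δ : ℝ} (hδ : 0 < δ)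
    (h : δ * n ≤ |2 * (k : ℝ) - n|) :
    (n.choose k : ℝ) ≤ 2 ^ n * Real.exp (-(δ ^ 2 / 2)) ^ n := by
  -- `(n.choose k) * exp (u * (2 * k - n))` is a term of the expansion of `(2 * cosh u) ^ n`.
  have key (u : ℝ) : (n.choose k : ℝ) * Real.exp (u * (2 * k - n)) ≤
      2 ^ n * Real.exp (u ^ 2 / 2) ^ n := by
    have h1 : (n.choose k : ℝ) * Real.exp (u * (2 * k - n)) =
        Real.exp u ^ k * Real.exp (-u) ^ (n - k) * n.choose k := by
      rw [← Real.exp_nat_mul, ← Real.exp_nat_mul, ← Real.exp_add, Nat.cast_sub hk, mul_comm]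
      congr 2
      ring
    rw [h1, ← mul_pow]
    calc _ ≤ (Real.exp u + Real.exp (-u)) ^ n := by
          rw [add_pow]
          exact Finset.single_le_sum (f := fun k =>
            Real.exp u ^ k * Real.exp (-u) ^ (n - k) * (n.choose k : ℝ))
            (fun i _ => by positivity) (Finset.mem_range.2 (Nat.lt_succ_of_le hk))
      _ ≤ _ := by
          refine pow_le_pow_left₀ (by positivity) ?_ n
          have := Real.cosh_le_exp_half_sq u
          rw [Real.cosh_eq] at this
          linarith
  -- The choice `u = ± δ`, with the sign of `2 * k - n`, minimizes `u ^ 2 / 2 - |u| * δ`.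
  obtain ⟨u, hu, hu'⟩ : ∃ u : ℝ, u ^ 2 = δ ^ 2 ∧ δ ^ 2 * n ≤ u * (2 * k - n) := by
    rcases le_abs'.1 h with h | h
    · exact ⟨-δ, by ring, by nlinarith⟩
    · exact ⟨δ, rfl, by nlinarith⟩
  have h1 := key u
  rw [hu] at h1
  have h2 : (n.choose k : ℝ) * Real.exp (δ ^ 2 * n) ≤ 2 ^ n * Real.exp (δ ^ 2 / 2) ^ n :=
    (mul_le_mul_of_nonneg_left (Real.exp_le_exp.2 hu') (Nat.cast_nonneg _)).trans h1
  rw [← le_div_iff₀ (Real.exp_pos _), mul_div_assoc] at h2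
  refine h2.trans (le_of_eq ?_)
  rw [← Real.exp_nat_mul, ← Real.exp_nat_mul, ← Real.exp_sub]
  congr 2
  ring

/-- The middle binomial coefficient is at least the average of all `n.choose k`. -/
theorem two_pow_le_franel (s n : ℕ) : (2 : ℝ) ^ (n * s) ≤ (n + 1) ^ s * franel s n := by
  have h1 : 2 ^ n ≤ (n + 1) * n.choose (n / 2) := by
    rw [← Nat.sum_range_choose]
    refine (Finset.sum_le_card_nsmul _ _ _ fun k _ => Nat.choose_le_middle k n).trans ?_
    simp
  have h2 : n.choose (n / 2) ^ s ≤ franel s n :=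
    Finset.single_le_sum (f := fun k => n.choose k ^ s) (fun _ _ => Nat.zero_le _)
      (Finset.mem_range.2 (by omega))
  have h3 : 2 ^ (n * s) ≤ (n + 1) ^ s * franel s n := by
    rw [pow_mul]
    refine (Nat.pow_le_pow_left h1 s).trans ?_
    rw [mul_pow]
    exact Nat.mul_le_mul_left _ h2
  exact_mod_cast h3

theorem franelCoeff_eq_sum (s j n : ℕ) :
    (franelCoeff s j n : ℝ) = ∑ k ∈ Finset.range (n + 1),
      (n.choose k : ℝ) ^ s * PowerSeries.coeff (2 * j) (invWeight n k ^ s) := by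
  rw [franelCoeff, franelSeries, map_sum, Rat.cast_sum]
  refine Finset.sum_congr rfl fun k _ => ?_
  rw [PowerSeries.coeff_C_mul, invWeight, ← map_pow, PowerSeries.coeff_map]
  push_cast
  rfl

theorem tendsto_pow_mul_geometric {r : ℝ} (hr0 : 0 < r) (hr1 : r < 1) (a : ℕ) :
    Filter.Tendsto (fun n : ℕ => ((n : ℝ) + 1) ^ a * r ^ n) Filter.atTop (nhds 0) := by
  have h := ((tendsto_pow_const_mul_const_pow_of_abs_lt_one a (r := r)
    (by rwa [abs_of_pos hr0])).comp (Filter.tendsto_add_atTop_nat 1)).div_const r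
  rw [zero_div] at h
  refine h.congr fun n => ?_
  simp only [Function.comp_apply]
  rw [pow_succ r n, ← mul_assoc, mul_div_cancel_right₀ _ hr0.ne', Nat.cast_succ]

/-- The terms with `k / n` close to `1 / 2` dominate the sum `franel s n`. -/
theorem tendsto_weighted_average {s : ℕ} (hs : 0 < s) {c : ℕ → ℕ → ℝ} {L : ℝ} {K : ℝ} {a : ℕ}
    (hc : Filter.Tendsto (fun p : ℕ × ℕ => c p.1 p.2) centralFilter (nhds L))
    (hK : ∀ n k, k ≤ n → |c n k| ≤ K * (n + 1) ^ a) :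
    Filter.Tendsto (fun n : ℕ => (∑ k ∈ Finset.range (n + 1), (n.choose k : ℝ) ^ s * c n k) /
      franel s n) Filter.atTop (nhds L) := by
  rw [Metric.tendsto_nhds]
  intro ε hε
  have h1 : ∀ᶠ p : ℕ × ℕ in centralFilter, |c p.1 p.2 - L| < ε / 2 := by
    simpa [Real.dist_eq] using Metric.tendsto_nhds.1 hc (ε / 2) (by positivity)
  obtain ⟨S, hS, T, hT, hST⟩ := Filter.eventually_inf.1 h1
  obtain ⟨S', hS', hSS⟩ := Filter.mem_comap.1 hS
  obtain ⟨T', hT', hTT⟩ := Filter.mem_comap.1 hT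
  obtain ⟨N, hN⟩ := Filter.mem_atTop_sets.1 hS'
  obtain ⟨δ, hδ, hball⟩ := Metric.mem_nhds_iff.1 hT'
  have hcent : ∀ n ≥ N, ∀ k, offCenter (n, k) < δ → |c n k - L| < ε / 2 := fun n hn k hk =>
    hST (n, k) ⟨hSS (hN n hn), hTT (hball (by
      rw [Metric.mem_ball, Real.dist_eq, sub_zero, abs_of_nonneg (by unfold offCenter; positivity)]
      exact hk))⟩
  set r := Real.exp (-(δ ^ 2 / 2)) with hr
  have hr1 : r < 1 := by
    rw [hr, Real.exp_lt_one_iff]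
    have := pow_pos hδ 2
    linarith
  have hr0 : 0 < r := Real.exp_pos _
  have hlim := (tendsto_pow_mul_geometric hr0 hr1 (a + s + 1)).const_mul (|K| + |L|)
  rw [mul_zero] at hlim
  filter_upwards [Filter.eventually_ge_atTop N, Filter.eventually_gt_atTop 0,
    hlim.eventually_lt_const (show 0 < ε / 2 by positivity)] with n hn hn0 hsmall
  have hA : (0 : ℝ) < franel s n := by
    have h := two_pow_le_franel s n
    have h' : (0 : ℝ) < (n + 1) ^ s * franel s n := lt_of_lt_of_le (by positivity) h
    exact pos_of_mul_pos_right h' (by positivity)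
  have hAsum : (franel s n : ℝ) = ∑ k ∈ Finset.range (n + 1), (n.choose k : ℝ) ^ s := by
    unfold franel; push_cast; rfl
  have hterm : ∀ k ∈ Finset.range (n + 1), |(n.choose k : ℝ) ^ s * (c n k - L)| ≤
      ε / 2 * (n.choose k : ℝ) ^ s + 2 ^ (n * s) * r ^ n * ((|K| + |L|) * (n + 1) ^ a) := by
    intro k hk
    have hkn : k ≤ n := Nat.lt_succ_iff.1 (Finset.mem_range.1 hk)
    rw [abs_mul, abs_of_nonneg (by positivity : (0 : ℝ) ≤ (n.choose k : ℝ) ^ s)]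
    by_cases ho : offCenter (n, k) < δ
    · refine le_add_of_le_of_nonneg ?_ (by positivity)
      rw [mul_comm]
      exact mul_le_mul_of_nonneg_right (hcent n hn k ho).le (by positivity)
    · refine le_add_of_nonneg_of_le (by positivity) ?_
      have hoff : δ * n ≤ |2 * (k : ℝ) - n| := by
        rw [← le_div_iff₀ (Nat.cast_pos.2 hn0)]
        exact not_lt.1 ho
      refine mul_le_mul ?_ ?_ (abs_nonneg _) (by positivity)
      · calc (n.choose k : ℝ) ^ s ≤ (2 ^ n * r ^ n) ^ s :=
              pow_le_pow_left₀ (by positivity) (choose_le_exp_of_offCenter hkn hδ hoff) s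
          _ = 2 ^ (n * s) * (r ^ n) ^ s := by rw [mul_pow, pow_mul]
          _ ≤ 2 ^ (n * s) * r ^ n := by
              refine mul_le_mul_of_nonneg_left ?_ (by positivity)
              exact pow_le_of_le_one (by positivity) (pow_le_one₀ hr0.le hr1.le) hs.ne'
      · have h3 : (1 : ℝ) ≤ (n + 1) ^ a := one_le_pow₀ (by linarith [Nat.cast_nonneg (α := ℝ) n])
        calc |c n k - L| ≤ |c n k| + |L| := abs_sub _ _
          _ ≤ |K| * (n + 1) ^ a + |L| * (n + 1) ^ a := by
              refine add_le_add ((hK n k hkn).trans ?_) (le_mul_of_one_le_right (abs_nonneg _) h3)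
              exact mul_le_mul_of_nonneg_right (le_abs_self K) (by positivity)
          _ = _ := by ring
  have hdiff : (∑ k ∈ Finset.range (n + 1), (n.choose k : ℝ) ^ s * c n k) / franel s n - L =
      (∑ k ∈ Finset.range (n + 1), (n.choose k : ℝ) ^ s * (c n k - L)) / franel s n := by
    simp only [mul_sub]
    rw [Finset.sum_sub_distrib, ← Finset.sum_mul, ← hAsum, sub_div, mul_div_cancel_left₀ _ hA.ne']
  rw [Real.dist_eq, hdiff, abs_div, abs_of_pos hA, div_lt_iff₀ hA]
  calc |∑ k ∈ Finset.range (n + 1), (n.choose k : ℝ) ^ s * (c n k - L)|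
      ≤ ∑ k ∈ Finset.range (n + 1), (ε / 2 * (n.choose k : ℝ) ^ s +
          2 ^ (n * s) * r ^ n * ((|K| + |L|) * (n + 1) ^ a)) :=
        (Finset.abs_sum_le_sum_abs _ _).trans (Finset.sum_le_sum hterm)
    _ = ε / 2 * franel s n + 2 ^ (n * s) * (r ^ n * ((|K| + |L|) * (n + 1) ^ (a + 1))) := by
        rw [Finset.sum_add_distrib, ← Finset.mul_sum, ← hAsum, Finset.sum_const,
          Finset.card_range, nsmul_eq_mul]
        push_cast
        ring
    _ ≤ ε / 2 * franel s n + ((n + 1) ^ s * franel s n) *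
          (r ^ n * ((|K| + |L|) * (n + 1) ^ (a + 1))) := by
        gcongr
        exact two_pow_le_franel s n
    _ = ε / 2 * franel s n +
          ((|K| + |L|) * (((n : ℝ) + 1) ^ (a + s + 1) * r ^ n)) * franel s n := by ring
    _ < ε / 2 * franel s n + ε / 2 * franel s n := by gcongr
    _ = ε * franel s n := by ring

theorem tendsto_franelCoeff_div_franel {s : ℕ} (hs : 0 < s) (j : ℕ) :
    Filter.Tendsto (fun n : ℕ => (franelCoeff s j n : ℝ) / (franel s n : ℝ)) Filter.atTop
      (nhds ((sinCoeff s j : ℝ) * Real.pi ^ (2 * j))) := by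
  simp only [franelCoeff_eq_sum]
  rw [← coeff_divSinPi_pow]
  refine tendsto_weighted_average hs (K := (s : ℝ) ^ (2 * j)) (a := 2 * j)
    (tendsto_coeff_invWeight_pow s (2 * j)) fun n k hk => ?_
  refine ((geometricBound_invWeight hk).pow (Nat.cast_nonneg n) s (2 * j)).trans ?_
  rw [mul_pow]
  gcongr
  linarith

/-! ### Positivity of the limit -/

/-- All coefficients of the power series are nonnegative. -/
def CoeffNonneg (f : PowerSeries ℝ) : Prop := ∀ m, 0 ≤ PowerSeries.coeff m f

theorem CoeffNonneg.mul {f g : PowerSeries ℝ} (hf : CoeffNonneg f) (hg : CoeffNonneg g) :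
    CoeffNonneg (f * g) := fun m => by
  rw [PowerSeries.coeff_mul]
  exact Finset.sum_nonneg fun x _ => mul_nonneg (hf _) (hg _)

theorem coeffNonneg_one : CoeffNonneg 1 := fun m => by
  rw [PowerSeries.coeff_one]
  split_ifs <;> norm_num

theorem CoeffNonneg.prod {ι : Type*} {S : Finset ι} {f : ι → PowerSeries ℝ}
    (hf : ∀ i ∈ S, CoeffNonneg (f i)) : CoeffNonneg (∏ i ∈ S, f i) :=
  Finset.prod_induction _ _ (fun _ _ => CoeffNonneg.mul) coeffNonneg_one hf

theorem CoeffNonneg.pow {f : PowerSeries ℝ} (hf : CoeffNonneg f) (s : ℕ) :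
    CoeffNonneg (f ^ s) := by
  simpa using CoeffNonneg.prod (S := Finset.range s) fun _ _ => hf

theorem inv_one_sub_C_mul_X_sq (a : ℝ) :
    (1 - PowerSeries.C a * PowerSeries.X ^ 2)⁻¹ =
      PowerSeries.mk fun m => if Even m then a ^ (m / 2) else 0 := by
  rw [eq_comm, PowerSeries.eq_inv_iff_mul_eq_one (by simp), mul_comm]
  ext m
  rw [sub_mul, one_mul, mul_assoc, map_sub, PowerSeries.coeff_C_mul, PowerSeries.coeff_one,
    PowerSeries.coeff_X_pow_mul', PowerSeries.coeff_mk]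
  rcases m with _ | _ | m
  · simp
  · simp
  · rw [if_pos (show 2 ≤ m + 1 + 1 by omega), if_neg (show ¬ m + 1 + 1 = 0 by omega),
      PowerSeries.coeff_mk, show m + 1 + 1 - 2 = m by omega,
      show m + 1 + 1 = m + 2 by omega, show (m + 2) / 2 = m / 2 + 1 by omega]
    by_cases h : Even m
    · rw [if_pos h, if_pos (h.add even_two)]
      ring
    · rw [if_neg h, if_neg (fun h' => h ((Nat.even_add.1 h').2 even_two)), mul_zero, sub_zero]

theorem coeffNonneg_prod_inv (S : Finset ℕ) :
    CoeffNonneg (∏ j ∈ S, (1 - PowerSeries.C (1 / (j : ℝ) ^ 2) * PowerSeries.X ^ 2)⁻¹) :=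
  CoeffNonneg.prod fun j _ m => by
    rw [inv_one_sub_C_mul_X_sq, PowerSeries.coeff_mk]
    split_ifs <;> positivity

/-- The factor `1 / (1 - t ^ 2)` alone contributes `1` to each even coefficient. -/
theorem one_le_coeff_inv_eulerSeries_pow {s : ℕ} (hs : 0 < s) {k : ℕ} (hk : 0 < k) (j : ℕ) :
    1 ≤ PowerSeries.coeff (2 * j) ((eulerSeries k)⁻¹ ^ s) := by
  obtain ⟨s, rfl⟩ := Nat.exists_eq_succ_of_ne_zero hs.ne'
  have he : (eulerSeries k)⁻¹ = (1 - PowerSeries.C 1 * PowerSeries.X ^ 2)⁻¹ *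
      ∏ j ∈ Finset.Ioc 1 k, (1 - PowerSeries.C (1 / (j : ℝ) ^ 2) * PowerSeries.X ^ 2)⁻¹ := by
    rw [eulerSeries, prod_inv, prod_Icc_one_eq_mul hk]
    simp
  set h := (∏ j ∈ Finset.Ioc 1 k,
    (1 - PowerSeries.C (1 / (j : ℝ) ^ 2) * PowerSeries.X ^ 2)⁻¹) * (eulerSeries k)⁻¹ ^ s with hh
  have hnonneg : CoeffNonneg h := by
    refine (coeffNonneg_prod_inv _).mul (CoeffNonneg.pow ?_ s)
    rw [eulerSeries, prod_inv]
    exact coeffNonneg_prod_inv _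
  have hconst : PowerSeries.coeff 0 h = 1 := by
    simp [hh, eulerSeries, map_prod]
  rw [pow_succ']
  nth_rewrite 1 [he]
  rw [mul_assoc, ← hh, PowerSeries.coeff_mul, inv_one_sub_C_mul_X_sq]
  have := Finset.single_le_sum (f := fun x : ℕ × ℕ => PowerSeries.coeff x.1
      (PowerSeries.mk fun m => if Even m then (1 : ℝ) ^ (m / 2) else 0) * PowerSeries.coeff x.2 h)
    (s := Finset.HasAntidiagonal.antidiagonal (2 * j)) (fun x _ => mul_nonneg (by
      rw [PowerSeries.coeff_mk]; split_ifs <;> positivity) (hnonneg _))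
    (show (2 * j, 0) ∈ Finset.HasAntidiagonal.antidiagonal (2 * j) by simp)
  simpa [hconst] using this

theorem sinCoeff_pos {s : ℕ} (hs : 0 < s) (j : ℕ) : 0 < sinCoeff s j := by
  have h1 : 1 ≤ (sinCoeff s j : ℝ) * Real.pi ^ (2 * j) := by
    rw [← coeff_divSinPi_pow]
    refine ge_of_tendsto (tendsto_coeff_pow tendsto_coeff_inv_eulerSeries s (2 * j)) ?_
    filter_upwards [Filter.eventually_gt_atTop 0] with k hk
    exact one_le_coeff_inv_eulerSeries_pow hs hk j
  have h2 : 0 < (sinCoeff s j : ℝ) :=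
    pos_of_mul_pos_left (one_pos.trans_le h1) (by positivity)
  exact_mod_cast h2

/-! ### Recurrences and limits of the coefficients -/

theorem theorem2 (s : ℕ) (hs : 0 < s) :
    (∀ n i : ℕ, PowerSeries.coeff (2 * i + 1) (franelSeries s n) = 0) ∧
    (∀ P : ℂ[X][X], IsTelescopingOperator s P →
      ∃ n₀ : ℕ, ∀ n ≥ n₀, ∀ j ≤ (s - 1) / 2,
        recurrenceApply P (fun m => (franelCoeff s j m : ℂ)) n = 0) ∧
    (∀ j : ℕ, 0 < sinCoeff s j ∧
      Filter.Tendsto (fun n : ℕ => (franelCoeff s j n : ℝ) / (franel s n : ℝ)) Filter.atTop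
        (nhds ((sinCoeff s j : ℝ) * Real.pi ^ (2 * j)))) :=
  ⟨coeff_odd_franelSeries s, fun _ hP => recurrenceApply_franelCoeff_eq_zero hs hP,
    fun j => ⟨sinCoeff_pos hs j, tendsto_franelCoeff_div_franel hs j⟩⟩
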